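/- Let $\Omega\subset\mathbb R^2$ be a bounded, non-empty, connected open set whose boundary is the union of finitely many pairwise disjoint simple Lipschitz loops (a simple Lipschitz loop is a closed, non-self-intersecting curve with at least two distinct points and a Lipschitz parametrization). Let $L^2(\Omega;\mathbb R^2)$ be the real Hilbert space of square-integrable planar vector fields with inner product $\langle v,w\rangle=\int_\Omega v\cdot w\,d^2x$, and let $$G(\Omega)=\{\nabla\varphi:\varphi\in H^1(\Omega)\},\qquad G_0(\Omega)=\{\nabla\varphi:\varphi\in H^1_0(\Omega)\}.$$ Let $P_G$ and $P_{G0}$ be the orthogonal projections of $L^2(\Omega;\mathbb R^2)$ onto (the closures in $L^2(\Omega;\mathbb R^2)$ of) $G(\Omega)$ and $G_0(\Omega)$, and let $Q_G=I-P_G$, $Q_{G0}=I-P_{G0}$. For an open set $\mathcal O\subset\Omega$ and an integer $m$, a field $v$ is said to be $H^m$ on $\mathcal O$ (in the sense of interior regularity) if each component of $v$ belongs to the Sobolev space $H^m(U)$ for every open set $U$ whose closure is a compact subset of $\mathcal O$; that is, the component and all its weak partial derivatives of order at most $m$ are in $L^2(U)$. Theorem. Let $\mathcal O$ be open with $\overline{\mathcal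 O}\subset\Omega$, let $m\ge 1$, and let $v\in L^2(\Omega;\mathbb R^2)$ be $H^m$ on $\mathcal O$. Then $P_Gv$, $P_{G0}v$, $Q_Gv$ and $Q_{G0}v$ are also $H^m$ on $\mathcal O$. -/

import Mathlib

open MeasureTheory Filter Topology
open scoped ContDiff ENNReal

noncomputable section

namespace PlanarField

/-- The Euclidean plane. -/
abbrev Plane : Type := EuclideanSpace ℝ (Fin 2)

/-- `S` is a simple Lipschitz loop: the image of a closed curve (a `1`-periodic map) with a
Lipschitz parametrization that is injective on one period. -/
def IsSimpleLipschitzLoop (S : Set Plane) : Prop :=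
  ∃ γ : ℝ → Plane, (∃ K, LipschitzWith K γ) ∧ Function.Periodic γ 1 ∧
    Set.InjOn γ (Set.Ico 0 1) ∧ Set.range γ = S

/-- A bounded region (non-empty connected open set) whose boundary is the union of finitely many
pairwise disjoint simple Lipschitz loops. -/
structure ConditionB1 (Ω : Set Plane) : Prop where
  isOpen : IsOpen Ω
  isConnected : IsConnected Ω
  isBounded : Bornology.IsBounded Ω
  boundary : ∃ (J : ℕ) (Γ : Fin (J + 1) → Set Plane), (∀ j, IsSimpleLipschitzLoop (Γ j)) ∧
    (∀ i j, i ≠ j → Disjoint (Γ i) (Γ j)) ∧ frontier Ω = ⋃ j, Γ j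

/-- The classical partial derivative `∂η/∂xᵢ`. -/
def partialDeriv (i : Fin 2) (η : Plane → ℝ) (x : Plane) : ℝ :=
  fderiv ℝ η x (EuclideanSpace.single i 1)

/-- `η` is a smooth function with compact support contained in `U`. -/
structure IsTest (U : Set Plane) (η : Plane → ℝ) : Prop where
  smooth : ContDiff ℝ ∞ η
  compact : HasCompactSupport η
  subset : tsupport η ⊆ U

/-- `g` is the weak `i`-th partial derivative of `f` on the open set `U`. -/
structure HasWeakPartial (U : Set Plane) (i : Fin 2) (f g : Plane → ℝ) : Prop where
  locInt : LocallyIntegrableOn f U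
  locInt_deriv : LocallyIntegrableOn g U
  integral_eq : ∀ η, IsTest U η →
    ∫ x in U, f x * partialDeriv i η x = -∫ x in U, g x * η x

/-- The Sobolev space `H^m(U)` on an open set `U`: the function and all its weak partial
derivatives of order at most `m` are square integrable on `U`. -/
def MemH : ℕ → Set Plane → (Plane → ℝ) → Prop
  | 0, U, f => MemLp f 2 (volume.restrict U)
  | m + 1, U, f => MemLp f 2 (volume.restrict U) ∧
      ∀ i, ∃ g, HasWeakPartial U i f g ∧ MemH m U g

/-- `f` is of class `H^m` on the open set `O` in the sense of interior regularity: it is in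
`H^m(U)` for every open `U` whose closure is a compact subset of `O`. -/
def IsClassH (m : ℕ) (O : Set Plane) (f : Plane → ℝ) : Prop :=
  ∀ U : Set Plane, IsOpen U → IsCompact (closure U) → closure U ⊆ O → MemH m U f

/-- The real Hilbert space `L²(Ω; ℝ²)`, with inner product `∫_Ω v · w`. -/
abbrev L2Field (Ω : Set Plane) : Type := Lp Plane 2 (volume.restrict Ω)

/-- A planar field is `H^m` on `O` when each of its two components is of class `H^m` on `O`. -/
def IsHOn {Ω : Set Plane} (m : ℕ) (O : Set Plane) (v : L2Field Ω) : Prop :=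
  ∀ i, IsClassH m O (fun x => v x i)

/-- `φ ∈ H¹(Ω)` and `w = ∇φ`. -/
structure IsGradOf (Ω : Set Plane) (φ : Plane → ℝ) (w : L2Field Ω) : Prop where
  memLp : MemLp φ 2 (volume.restrict Ω)
  weak : ∀ i, HasWeakPartial Ω i φ (fun x => w x i)

/-- `φ ∈ H¹₀(Ω)` and `w = ∇φ`, where `H¹₀(Ω)` is the closure in `H¹(Ω)` of the smooth functions
with compact support in `Ω`. -/
structure IsGradOfZero (Ω : Set Plane) (φ : Plane → ℝ) (w : L2Field Ω) : Prop where
  isGrad : IsGradOf Ω φ w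
  approx : ∃ η : ℕ → Plane → ℝ, (∀ n, IsTest Ω (η n)) ∧
    Tendsto (fun n => eLpNorm (fun x => η n x - φ x) 2 (volume.restrict Ω)) atTop (𝓝 0) ∧
    ∀ i, Tendsto (fun n => eLpNorm (fun x => partialDeriv i (η n) x - w x i) 2
      (volume.restrict Ω)) atTop (𝓝 0)

section linear

variable {Ω : Set Plane}

theorem IsTest.zero : IsTest Ω (fun _ => 0) := by
  refine ⟨contDiff_const, ?_, ?_⟩
  · exact HasCompactSupport.zero
  · have : tsupport (fun _ : Plane => (0 : ℝ)) = ∅ := tsupport_eq_empty_iff.2 rfl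
    simp [this]

theorem IsTest.add {η ζ : Plane → ℝ} (hη : IsTest Ω η) (hζ : IsTest Ω ζ) :
    IsTest Ω (fun x => η x + ζ x) :=
  ⟨hη.smooth.add hζ.smooth, hη.compact.add hζ.compact,
    (tsupport_add η ζ).trans (Set.union_subset hη.subset hζ.subset)⟩

theorem IsTest.smul {η : Plane → ℝ} (c : ℝ) (hη : IsTest Ω η) : IsTest Ω (fun x => c * η x) :=
  ⟨contDiff_const.mul hη.smooth, hη.compact.mul_left,
    (tsupport_mul_subset_right (f := fun _ => c) (g := η)).trans hη.subset⟩

theorem IsTest.continuous_partialDeriv {η : Plane → ℝ} (hη : IsTest Ω η) (i : Fin 2) :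
    Continuous (partialDeriv i η) :=
  (hη.smooth.continuous_fderiv (by simp)).clm_apply continuous_const

theorem IsTest.memLp {η : Plane → ℝ} (hη : IsTest Ω η) :
    MemLp η 2 (volume.restrict Ω) :=
  (hη.smooth.continuous.memLp_of_hasCompactSupport hη.compact).restrict Ω

theorem IsTest.memLp_partialDeriv {η : Plane → ℝ} (hη : IsTest Ω η) (i : Fin 2) :
    MemLp (partialDeriv i η) 2 (volume.restrict Ω) := by
  refine ((hη.continuous_partialDeriv i).memLp_of_hasCompactSupport ?_).restrict Ω
  exact (hη.compact.fderiv ℝ).comp_left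
    (g := fun L : Plane →L[ℝ] ℝ => L (EuclideanSpace.single i 1)) rfl

theorem partialDeriv_add {η ζ : Plane → ℝ} (hη : IsTest Ω η) (hζ : IsTest Ω ζ) (i : Fin 2)
    (x : Plane) :
    partialDeriv i (fun y => η y + ζ y) x = partialDeriv i η x + partialDeriv i ζ x := by
  unfold partialDeriv
  rw [fderiv_fun_add (hη.smooth.differentiable (by simp) x)
    (hζ.smooth.differentiable (by simp) x)]
  rfl

theorem partialDeriv_smul {η : Plane → ℝ} (c : ℝ) (hη : IsTest Ω η) (i : Fin 2) (x : Plane) :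
    partialDeriv i (fun y => c * η y) x = c * partialDeriv i η x := by
  unfold partialDeriv
  rw [fderiv_const_mul (hη.smooth.differentiable (by simp) x)]
  rfl

theorem L2Field.memLp_apply (w : L2Field Ω) (i : Fin 2) :
    MemLp (fun x => w x i) 2 (volume.restrict Ω) :=
  (EuclideanSpace.proj (𝕜 := ℝ) i : Plane →L[ℝ] ℝ).comp_memLp' (Lp.memLp w)

theorem L2Field.coe_add_apply (w z : L2Field Ω) :
    ∀ᵐ x ∂volume.restrict Ω, ∀ i, (w + z) x i = w x i + z x i := by
  filter_upwards [Lp.coeFn_add w z] with x hx i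
  rw [hx]; rfl

theorem L2Field.coe_smul_apply (c : ℝ) (w : L2Field Ω) :
    ∀ᵐ x ∂volume.restrict Ω, ∀ i, (c • w) x i = c * w x i := by
  filter_upwards [Lp.coeFn_smul c w] with x hx i
  rw [hx]; rfl

theorem L2Field.coe_zero_apply :
    ∀ᵐ x ∂volume.restrict Ω, ∀ i, (0 : L2Field Ω) x i = 0 := by
  filter_upwards [Lp.coeFn_zero Plane 2 (volume.restrict Ω)] with x hx i
  rw [hx]; rfl

theorem locallyIntegrableOn_of_memLp {f : Plane → ℝ} (hf : MemLp f 2 (volume.restrict Ω)) :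
    LocallyIntegrableOn f Ω :=
  locallyIntegrableOn_of_locallyIntegrable_restrict (hf.locallyIntegrable (by norm_num))

theorem IsGradOf.zero : IsGradOf Ω (fun _ => 0) 0 := by
  refine ⟨MemLp.zero', fun i => ⟨locallyIntegrableOn_of_memLp MemLp.zero',
    locallyIntegrableOn_of_memLp (L2Field.memLp_apply 0 i), fun η _ => ?_⟩⟩
  have h : ∫ x in Ω, (0 : L2Field Ω) x i * η x = 0 :=
    integral_eq_zero_of_ae (by
      filter_upwards [L2Field.coe_zero_apply (Ω := Ω)] with x hx
      rw [hx i, zero_mul]; rfl)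
  rw [h]
  simp

theorem IsGradOf.add {φ ψ : Plane → ℝ} {w z : L2Field Ω} (h : IsGradOf Ω φ w)
    (k : IsGradOf Ω ψ z) : IsGradOf Ω (fun x => φ x + ψ x) (w + z) := by
  refine ⟨h.memLp.add k.memLp, fun i => ⟨locallyIntegrableOn_of_memLp (h.memLp.add k.memLp),
    locallyIntegrableOn_of_memLp (L2Field.memLp_apply _ i), fun η hη => ?_⟩⟩
  have e : ∫ x in Ω, (w + z) x i * η x = ∫ x in Ω, (w x i * η x + z x i * η x) :=
    integral_congr_ae (by
      filter_upwards [L2Field.coe_add_apply w z] with x hx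
      simp only [hx i]; ring)
  have hp := hη.memLp_partialDeriv i
  have e₁ : ∫ x in Ω, (w x i * η x + z x i * η x) =
      (∫ x in Ω, w x i * η x) + ∫ x in Ω, z x i * η x :=
    integral_add ((L2Field.memLp_apply w i).integrable_mul hη.memLp)
      ((L2Field.memLp_apply z i).integrable_mul hη.memLp)
  have e₂ : ∫ x in Ω, (φ x * partialDeriv i η x + ψ x * partialDeriv i η x) =
      (∫ x in Ω, φ x * partialDeriv i η x) + ∫ x in Ω, ψ x * partialDeriv i η x :=
    integral_add (h.memLp.integrable_mul hp) (k.memLp.integrable_mul hp)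
  simp only [add_mul]
  rw [e, e₁, e₂, (h.weak i).integral_eq η hη, (k.weak i).integral_eq η hη]
  ring

theorem IsGradOf.smul {φ : Plane → ℝ} {w : L2Field Ω} (c : ℝ) (h : IsGradOf Ω φ w) :
    IsGradOf Ω (fun x => c * φ x) (c • w) := by
  refine ⟨h.memLp.const_mul c, fun i => ⟨locallyIntegrableOn_of_memLp (h.memLp.const_mul c),
    locallyIntegrableOn_of_memLp (L2Field.memLp_apply _ i), fun η hη => ?_⟩⟩
  have e : ∫ x in Ω, (c • w) x i * η x = ∫ x in Ω, c * (w x i * η x) :=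
    integral_congr_ae (by
      filter_upwards [L2Field.coe_smul_apply c w] with x hx
      simp only [hx i]; ring)
  rw [e, integral_const_mul]
  simp only [mul_assoc]
  rw [integral_const_mul, (h.weak i).integral_eq η hη]
  ring

theorem IsGradOfZero.zero : IsGradOfZero Ω (fun _ => 0) 0 := by
  refine ⟨IsGradOf.zero, fun _ _ => 0, fun _ => IsTest.zero, by simp, fun i => ?_⟩
  have e : eLpNorm (fun x => partialDeriv i (fun _ => 0) x - (0 : L2Field Ω) x i) 2
      (volume.restrict Ω) = 0 := by
    rw [eLpNorm_congr_ae (g := fun _ => (0 : ℝ)) ?_]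
    · simp
    · filter_upwards [L2Field.coe_zero_apply (Ω := Ω)] with x hx
      rw [hx i]
      simp [partialDeriv]
  simp only [e]
  exact tendsto_const_nhds

theorem tendsto_eLpNorm_add {f g h : ℕ → Plane → ℝ}
    (hf : ∀ n, AEStronglyMeasurable (f n) (volume.restrict Ω))
    (hg : ∀ n, AEStronglyMeasurable (g n) (volume.restrict Ω))
    (e : ∀ n, h n =ᵐ[volume.restrict Ω] fun x => f n x + g n x)
    (tf : Tendsto (fun n => eLpNorm (f n) 2 (volume.restrict Ω)) atTop (𝓝 0))
    (tg : Tendsto (fun n => eLpNorm (g n) 2 (volume.restrict Ω)) atTop (𝓝 0)) :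
    Tendsto (fun n => eLpNorm (h n) 2 (volume.restrict Ω)) atTop (𝓝 0) := by
  refine tendsto_of_tendsto_of_tendsto_of_le_of_le tendsto_const_nhds
    (by simpa using tf.add tg) (fun n => bot_le) (fun n => ?_)
  rw [eLpNorm_congr_ae (e n)]
  exact eLpNorm_add_le (hf n) (hg n) (by norm_num)

theorem tendsto_eLpNorm_smul {f h : ℕ → Plane → ℝ} (c : ℝ)
    (e : ∀ n, h n =ᵐ[volume.restrict Ω] fun x => c * f n x)
    (tf : Tendsto (fun n => eLpNorm (f n) 2 (volume.restrict Ω)) atTop (𝓝 0)) :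
    Tendsto (fun n => eLpNorm (h n) 2 (volume.restrict Ω)) atTop (𝓝 0) := by
  have : Tendsto (fun n => ‖c‖ₑ * eLpNorm (f n) 2 (volume.restrict Ω)) atTop (𝓝 0) := by
    simpa using ENNReal.Tendsto.const_mul tf (Or.inr enorm_ne_top)
  refine this.congr fun n => ?_
  rw [eLpNorm_congr_ae (e n)]
  exact (eLpNorm_const_smul c (f n) 2 _).symm

theorem IsGradOfZero.add {φ ψ : Plane → ℝ} {w z : L2Field Ω} (h : IsGradOfZero Ω φ w)
    (k : IsGradOfZero Ω ψ z) : IsGradOfZero Ω (fun x => φ x + ψ x) (w + z) := by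
  obtain ⟨η, tη, aη, bη⟩ := h.approx
  obtain ⟨ζ, tζ, aζ, bζ⟩ := k.approx
  refine ⟨h.isGrad.add k.isGrad, fun n x => η n x + ζ n x, fun n => (tη n).add (tζ n),
    tendsto_eLpNorm_add (fun n => ((tη n).memLp.sub h.isGrad.memLp).1)
      (fun n => ((tζ n).memLp.sub k.isGrad.memLp).1)
      (fun n => ae_of_all _ fun x => ?_) aη aζ,
    fun i => tendsto_eLpNorm_add
      (fun n => (((tη n).memLp_partialDeriv i).sub (w.memLp_apply i)).1)
      (fun n => (((tζ n).memLp_partialDeriv i).sub (z.memLp_apply i)).1)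
      (fun n => ?_) (bη i) (bζ i)⟩
  · simp only [Pi.sub_apply]; ring
  · filter_upwards [L2Field.coe_add_apply w z] with x hx
    simp only [partialDeriv_add (tη n) (tζ n), hx i, Pi.sub_apply]; ring

theorem IsGradOfZero.smul {φ : Plane → ℝ} {w : L2Field Ω} (c : ℝ) (h : IsGradOfZero Ω φ w) :
    IsGradOfZero Ω (fun x => c * φ x) (c • w) := by
  obtain ⟨η, tη, aη, bη⟩ := h.approx
  refine ⟨h.isGrad.smul c, fun n x => c * η n x, fun n => (tη n).smul c,
    tendsto_eLpNorm_smul c (fun n => ae_of_all _ fun x => ?_) aη,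
    fun i => tendsto_eLpNorm_smul c (fun n => ?_) (bη i)⟩
  · ring
  · filter_upwards [L2Field.coe_smul_apply c w] with x hx
    simp only [partialDeriv_smul c (tη n), hx i]; ring

end linear

/-- `G(Ω)`, the subspace of gradients of functions in `H¹(Ω)`. -/
def gradSpace (Ω : Set Plane) : Submodule ℝ (L2Field Ω) where
  carrier := {w | ∃ φ, IsGradOf Ω φ w}
  zero_mem' := ⟨_, IsGradOf.zero⟩
  add_mem' := fun ⟨_, h⟩ ⟨_, k⟩ => ⟨_, h.add k⟩
  smul_mem' := fun c _ ⟨_, h⟩ => ⟨_, h.smul c⟩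

/-- `G₀(Ω)`, the subspace of gradients of functions in `H¹₀(Ω)`. -/
def gradSpaceZero (Ω : Set Plane) : Submodule ℝ (L2Field Ω) where
  carrier := {w | ∃ φ, IsGradOfZero Ω φ w}
  zero_mem' := ⟨_, IsGradOfZero.zero⟩
  add_mem' := fun ⟨_, h⟩ ⟨_, k⟩ => ⟨_, h.add k⟩
  smul_mem' := fun c _ ⟨_, h⟩ => ⟨_, h.smul c⟩

/-- `P_G`, the orthogonal projection of `L²(Ω; ℝ²)` onto (the closure of) `G(Ω)`. When `G(Ω)` is
closed it is the projection onto `G(Ω)` itself, with `P_G v = -∇φ` for the minimizer `φ` of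
`∫_Ω (|∇φ|² + 2 v · ∇φ)` over `H¹(Ω)`. -/
def projG (Ω : Set Plane) : L2Field Ω →L[ℝ] L2Field Ω :=
  (gradSpace Ω).topologicalClosure.starProjection

/-- `P_{G0}`, the orthogonal projection of `L²(Ω; ℝ²)` onto (the closure of) `G₀(Ω)`. When `G₀(Ω)`
is closed it is the projection onto `G₀(Ω)` itself, with `P_{G0} v = -∇φ` for the minimizer `φ` of
`∫_Ω (|∇φ|² + 2 v · ∇φ)` over `H¹₀(Ω)`. -/
def projG0 (Ω : Set Plane) : L2Field Ω →L[ℝ] L2Field Ω :=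
  (gradSpaceZero Ω).topologicalClosure.starProjection

/-- The complementary projection `Q_G = I - P_G`. -/
def compG (Ω : Set Plane) : L2Field Ω →L[ℝ] L2Field Ω :=
  ContinuousLinearMap.id ℝ (L2Field Ω) - projG Ω

/-- The complementary projection `Q_{G0} = I - P_{G0}`. -/
def compG0 (Ω : Set Plane) : L2Field Ω →L[ℝ] L2Field Ω :=
  ContinuousLinearMap.id ℝ (L2Field Ω) - projG0 Ω

end PlanarField

end

noncomputable section

namespace PlanarField

/-! Let `S` be `G(Ω)` or `G₀(Ω)`, and `w` the projection of `v` onto the closure of `S`. As an `L²`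
limit of gradients, `w` is weakly curl-free. As `v - w` is orthogonal to the gradient of every test
function, `div w = div v` weakly. So on `O` the field `w` solves a div-curl system with curl zero
and divergence one order less regular than `v`, and interior elliptic regularity
(`memH_succ_of_div_curl`) gives back that order.

The regularity rests on the identity `∫ |Dη|² = ∫ (div η)² + ∫ (curl η)²` for smooth compactly
supported fields. Mollification and a weak limit extend the resulting bound to `L²` fields of
compact support (`exists_weak_partial_of_div_curl`). A cutoff localizes it, and differentiating the
system raises the order by induction. The curl is treated throughout as the divergence of the
rotated field `(-f₁, f₀)`, so each fact about weak divergence serves twice. The complementary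
projections follow by subtraction. -/

/-! ### Calculus of test functions and the energy identity -/

theorem partialDeriv_eq_zero {η : Plane → ℝ} {x : Plane} (hx : x ∉ tsupport η) (i : Fin 2) :
    partialDeriv i η x = 0 := by
  have : fderiv ℝ η x = 0 := by
    by_contra h
    exact hx (support_fderiv_subset ℝ h)
  simp [partialDeriv, this]

theorem partialDeriv_mul {η ζ : Plane → ℝ} (hη : ContDiff ℝ ∞ η) (hζ : ContDiff ℝ ∞ ζ)
    (i : Fin 2) (x : Plane) :
    partialDeriv i (fun y => η y * ζ y) x = η x * partialDeriv i ζ x + partialDeriv i η x * ζ x := by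
  unfold partialDeriv
  rw [fderiv_fun_mul (hη.differentiable (by simp) x) (hζ.differentiable (by simp) x)]
  simp [mul_comm]

theorem contDiff_partialDeriv {η : Plane → ℝ} (hη : ContDiff ℝ ∞ η) (i : Fin 2) :
    ContDiff ℝ ∞ (partialDeriv i η) :=
  (hη.fderiv_right (m := ∞) (by simp)).clm_apply contDiff_const

theorem partialDeriv_comm {η : Plane → ℝ} (hη : ContDiff ℝ ∞ η) (i j : Fin 2) (x : Plane) :
    partialDeriv i (partialDeriv j η) x = partialDeriv j (partialDeriv i η) x := by
  have key : ∀ i j : Fin 2, partialDeriv i (partialDeriv j η) x =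
      fderiv ℝ (fderiv ℝ η) x (EuclideanSpace.single i 1) (EuclideanSpace.single j 1) := by
    intro i j
    have hd : DifferentiableAt ℝ (fderiv ℝ η) x :=
      (hη.fderiv_right (m := ∞) (by simp)).differentiable (by simp) x
    change fderiv ℝ (fun y => fderiv ℝ η y (EuclideanSpace.single j 1)) x _ = _
    rw [fderiv_clm_apply hd (differentiableAt_const _)]
    simp
  rw [key, key]
  exact ((contDiff_infty.1 hη 2).contDiffAt.isSymmSndFDerivAt (by simp)) _ _

theorem IsTest.mono {U V : Set Plane} {η : Plane → ℝ} (hη : IsTest U η) (h : U ⊆ V) :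
    IsTest V η :=
  ⟨hη.smooth, hη.compact, hη.subset.trans h⟩

theorem IsTest.partialDeriv {U : Set Plane} {η : Plane → ℝ} (hη : IsTest U η) (i : Fin 2) :
    IsTest U (partialDeriv i η) := by
  have hs : tsupport (PlanarField.partialDeriv i η) ⊆ tsupport η := by
    refine closure_minimal (fun x hx => ?_) (isClosed_tsupport η)
    by_contra h
    exact hx (partialDeriv_eq_zero h i)
  exact ⟨contDiff_partialDeriv hη.smooth i, hη.compact.of_isClosed_subset (isClosed_tsupport _) hs,
    hs.trans hη.subset⟩

theorem IsTest.mul_left {U : Set Plane} {χ η : Plane → ℝ} (hχ : ContDiff ℝ ∞ χ)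
    (hη : IsTest U η) : IsTest U (fun x => χ x * η x) :=
  ⟨hχ.mul hη.smooth, hη.compact.mul_left,
    (tsupport_mul_subset_right (f := χ) (g := η)).trans hη.subset⟩

theorem IsTest.eq_zero {U : Set Plane} {η : Plane → ℝ} (hη : IsTest U η) {x : Plane}
    (hx : x ∉ U) : η x = 0 :=
  image_eq_zero_of_notMem_tsupport fun h => hx (hη.subset h)

theorem IsTest.partialDeriv_eq_zero {U : Set Plane} {η : Plane → ℝ} (hη : IsTest U η) {x : Plane}
    (hx : x ∉ U) (i : Fin 2) : PlanarField.partialDeriv i η x = 0 :=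
  PlanarField.partialDeriv_eq_zero (fun h => hx (hη.subset h)) i

theorem IsTest.integrable_mul {U : Set Plane} {η f : Plane → ℝ} (hη : IsTest U η)
    (hf : MemLp f 2 (volume.restrict U)) :
    Integrable (fun x => f x * η x) (volume.restrict U) :=
  hf.integrable_mul hη.memLp

theorem IsTest.integrable_mul_univ {U : Set Plane} {η ζ : Plane → ℝ} (hη : IsTest U η)
    (hζ : IsTest U ζ) : Integrable (fun x => η x * ζ x) :=
  (hη.smooth.continuous.mul hζ.smooth.continuous).integrable_of_hasCompactSupport
    hη.compact.mul_right

theorem IsTest.integral_mul_partialDeriv {U : Set Plane} {η ζ : Plane → ℝ} (hη : IsTest U η)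
    (hζ : IsTest U ζ) (i : Fin 2) :
    ∫ x, η x * PlanarField.partialDeriv i ζ x = -∫ x, PlanarField.partialDeriv i η x * ζ x :=
  integral_mul_fderiv_eq_neg_fderiv_mul_of_integrable ((hη.partialDeriv i).integrable_mul_univ hζ)
    (hη.integrable_mul_univ (hζ.partialDeriv i)) (hη.integrable_mul_univ hζ)
    (fun x _ => hη.smooth.differentiable (by simp) x)
    (fun x _ => hζ.smooth.differentiable (by simp) x)

/-- The Jacobian determinant of `(η, ζ)` is a null Lagrangian: one integration by parts turns either
side into minus the integral of `η` against the same mixed second derivative of `ζ`. -/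
theorem IsTest.integral_partialDeriv_mul_comm {U : Set Plane} {η ζ : Plane → ℝ} (hη : IsTest U η)
    (hζ : IsTest U ζ) :
    ∫ x, PlanarField.partialDeriv 0 η x * PlanarField.partialDeriv 1 ζ x =
      ∫ x, PlanarField.partialDeriv 1 η x * PlanarField.partialDeriv 0 ζ x := by
  have h₁ := hη.integral_mul_partialDeriv (hζ.partialDeriv 1) 0
  have h₂ := hη.integral_mul_partialDeriv (hζ.partialDeriv 0) 1
  simp only [partialDeriv_comm hζ.smooth 0 1] at h₁
  linarith

/-- The energy identity `∫ |Dη|² = ∫ (div η)² + ∫ (curl η)²` for smooth compactly supported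
fields, as an upper bound for a single entry of `Dη`. -/
theorem IsTest.integral_sq_partialDeriv_le {U : Set Plane} {η : Fin 2 → Plane → ℝ}
    (hη : ∀ j, IsTest U (η j)) (i j : Fin 2) :
    ∫ x, PlanarField.partialDeriv i (η j) x ^ 2 ≤
      (∫ x, (PlanarField.partialDeriv 0 (η 0) x + PlanarField.partialDeriv 1 (η 1) x) ^ 2) +
      ∫ x, (PlanarField.partialDeriv 1 (η 0) x - PlanarField.partialDeriv 0 (η 1) x) ^ 2 := by
  have I : ∀ i j k l : Fin 2, Integrable (fun x => PlanarField.partialDeriv i (η j) x *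
      PlanarField.partialDeriv k (η l) x) := fun i j k l =>
    ((hη j).partialDeriv i).integrable_mul_univ ((hη l).partialDeriv k)
  have h := (hη 0).integral_partialDeriv_mul_comm (hη 1)
  have hd : Integrable (fun x => (PlanarField.partialDeriv 0 (η 0) x +
      PlanarField.partialDeriv 1 (η 1) x) ^ 2) :=
    (((I 0 0 0 0).add ((I 0 0 1 1).const_mul 2)).add (I 1 1 1 1)).congr
      (ae_of_all _ fun x => by simp only [Pi.add_apply]; ring)
  have hc : Integrable (fun x => (PlanarField.partialDeriv 1 (η 0) x -
      PlanarField.partialDeriv 0 (η 1) x) ^ 2) :=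
    (((I 1 0 1 0).sub ((I 1 0 0 1).const_mul 2)).add (I 0 1 0 1)).congr
      (ae_of_all _ fun x => by simp only [Pi.add_apply, Pi.sub_apply]; ring)
  -- Pointwise, `(div η)² + (curl η)²` is the sum of the four squares plus twice the Jacobian
  -- determinant. Adding this term, whose integral is zero, leaves exactly the sum of squares.
  have hx : Integrable (fun x => 2 * (PlanarField.partialDeriv 1 (η 0) x *
      PlanarField.partialDeriv 0 (η 1) x - PlanarField.partialDeriv 0 (η 0) x *
      PlanarField.partialDeriv 1 (η 1) x)) := ((I 1 0 0 1).sub (I 0 0 1 1)).const_mul 2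
  have hx₀ : ∫ x, 2 * (PlanarField.partialDeriv 1 (η 0) x *
      PlanarField.partialDeriv 0 (η 1) x - PlanarField.partialDeriv 0 (η 0) x *
      PlanarField.partialDeriv 1 (η 1) x) = 0 := by
    rw [integral_const_mul, integral_sub (I 1 0 0 1) (I 0 0 1 1), h, sub_self, mul_zero]
  rw [← integral_add' hd hc, ← add_zero (integral _ ((fun _ => _) + _)), ← hx₀, ← integral_add' (hd.add hc) hx]
  refine integral_mono (by simpa only [sq] using I i j i j) ((hd.add hc).add hx) fun x => ?_
  simp only [Pi.add_apply]
  fin_cases i <;> fin_cases j <;> simp only [Fin.zero_eta, Fin.mk_one] <;>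
    nlinarith [sq_nonneg (PlanarField.partialDeriv 0 (η 0) x),
      sq_nonneg (PlanarField.partialDeriv 0 (η 1) x),
      sq_nonneg (PlanarField.partialDeriv 1 (η 0) x),
      sq_nonneg (PlanarField.partialDeriv 1 (η 1) x)]

/-- A bounded sequence in a real Hilbert space converges weakly along the hyperfilter. -/
theorem exists_weak_limit {H : Type*} [NormedAddCommGroup H] [InnerProductSpace ℝ H]
    [CompleteSpace H] (g : ℕ → H) (C : ℝ) (hg : ∀ n, ‖g n‖ ≤ C) :
    ∃ h : H, ∀ f : H, Tendsto (fun n => inner ℝ (g n) f) (hyperfilter ℕ) (𝓝 (inner ℝ h f)) := by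
  -- Banach–Alaoglu: the images of the `g n` lie in a weak-* compact ball. Following an ultrafilter
  -- replaces the extraction of a subsequence, so no separability is needed.
  let F : ℕ → WeakDual ℝ H := fun n => StrongDual.toWeakDual (InnerProductSpace.toDual ℝ H (g n))
  have hK := WeakDual.isCompact_closedBall (𝕜 := ℝ) (0 : StrongDual ℝ H) C
  obtain ⟨ℓ, -, hℓ⟩ := hK.ultrafilter_le_nhds ((hyperfilter ℕ).map F) (by
    refine le_principal_iff.2 (Filter.mem_map.2 (univ_mem' fun n => ?_))
    simpa [F] using hg n)
  refine ⟨(InnerProductSpace.toDual ℝ H).symm (WeakDual.toStrongDual ℓ), fun f => ?_⟩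
  have h : Tendsto F (hyperfilter ℕ) (𝓝 ℓ) := hℓ
  have := ((WeakDual.eval_continuous f).tendsto ℓ).comp h
  simpa [F, Function.comp_def] using this

/-- `b` is the weak divergence of the field `(f, g)` on `U`. -/
def HasWeakDiv (U : Set Plane) (f g b : Plane → ℝ) : Prop :=
  ∀ η, IsTest U η →
    ∫ x in U, (f x * partialDeriv 0 η x + g x * partialDeriv 1 η x) = -∫ x in U, b x * η x

/-- The convolution of `u` with the kernel `ρ`. -/
def mollify (ρ u : Plane → ℝ) : Plane → ℝ :=
  convolution u ρ (ContinuousLinearMap.lsmul ℝ ℝ) volume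

theorem mollify_apply (ρ u : Plane → ℝ) (x : Plane) :
    mollify ρ u x = ∫ t, u t * ρ (x - t) := rfl

/-! ### Mollification, and the div-curl estimate on the whole plane -/

section Mollify

variable {ρ u : Plane → ℝ}

theorem IsTest.integrable_mul_translate (hρ : IsTest Set.univ ρ) (hu : LocallyIntegrable u)
    (x : Plane) : Integrable (fun t => u t * ρ (x - t)) :=
  hρ.compact.convolutionExists_right (ContinuousLinearMap.lsmul ℝ ℝ) hu hρ.smooth.continuous x

theorem IsTest.mollify (hρ : IsTest Set.univ ρ) (hu : LocallyIntegrable u)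
    (hc : HasCompactSupport u) : IsTest Set.univ (mollify ρ u) :=
  ⟨hρ.compact.contDiff_convolution_right _ hu hρ.smooth, hc.convolution _ hρ.compact,
    Set.subset_univ _⟩

theorem IsTest.partialDeriv_mollify (hρ : IsTest Set.univ ρ) (hu : LocallyIntegrable u)
    (i : Fin 2) (x : Plane) :
    PlanarField.partialDeriv i (PlanarField.mollify ρ u) x =
      ∫ t, u t * PlanarField.partialDeriv i ρ (x - t) := by
  unfold PlanarField.partialDeriv PlanarField.mollify
  rw [(hρ.compact.hasFDerivAt_convolution_right _ hu (hρ.smooth.of_le (by simp)) x).fderiv,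
    convolution_precompR_apply _ hu (hρ.compact.fderiv ℝ)
      (hρ.smooth.continuous_fderiv (by simp))]
  rfl

theorem IsTest.reflect (hρ : IsTest Set.univ ρ) (x : Plane) :
    IsTest Set.univ (fun t => ρ (x - t)) :=
  ⟨hρ.smooth.comp (contDiff_const.sub contDiff_id),
    hρ.compact.comp_homeomorph (Homeomorph.subLeft x), Set.subset_univ _⟩

theorem IsTest.partialDeriv_reflect (hρ : IsTest Set.univ ρ) (x t : Plane) (i : Fin 2) :
    PlanarField.partialDeriv i (fun t => ρ (x - t)) t = -PlanarField.partialDeriv i ρ (x - t) := by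
  have h : HasFDerivAt (fun t => ρ (x - t)) ((fderiv ℝ ρ (x - t)).comp
      (-ContinuousLinearMap.id ℝ Plane)) t :=
    (hρ.smooth.differentiable (by simp) (x - t)).hasFDerivAt.comp t
      ((hasFDerivAt_id t).const_sub x)
  unfold PlanarField.partialDeriv
  rw [h.fderiv]
  simp

/-- Testing the weak equation with `t ↦ ρ (x - t)` makes it classical; the sign from differentiating
the reflection cancels the sign in the weak formulation. -/
theorem HasWeakDiv.mollify {f g b : Plane → ℝ} (h : HasWeakDiv Set.univ f g b)
    (hf : LocallyIntegrable f) (hg : LocallyIntegrable g) (hρ : IsTest Set.univ ρ) (x : Plane) :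
    partialDeriv 0 (mollify ρ f) x + partialDeriv 1 (mollify ρ g) x = mollify ρ b x := by
  have e := h _ (hρ.reflect x)
  simp only [hρ.partialDeriv_reflect, Measure.restrict_univ] at e
  rw [hρ.partialDeriv_mollify hf, hρ.partialDeriv_mollify hg, mollify_apply,
    ← neg_neg (∫ t, b t * ρ (x - t)), ← e, ← integral_neg,
    ← integral_add ((hρ.partialDeriv 0).integrable_mul_translate hf x)
      ((hρ.partialDeriv 1).integrable_mul_translate hg x)]
  congr 1
  ext t
  ring

/-- Convolution with a probability density does not increase the `L²` norm. -/
theorem IsTest.integral_sq_mollify_le (hρ : IsTest Set.univ ρ) (h₀ : ∀ x, 0 ≤ ρ x)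
    (h₁ : ∫ x, ρ x = 1) (hu : MemLp u 2) :
    ∫ x, PlanarField.mollify ρ u x ^ 2 ≤ ∫ x, u x ^ 2 := by
  have hρi : Integrable ρ := hρ.smooth.continuous.integrable_of_hasCompactSupport hρ.compact
  have hu₂ : Integrable (fun x => u x ^ 2) := hu.integrable_sq
  have hl : LocallyIntegrable u := hu.locallyIntegrable (by norm_num)
  have e : ∫ x, PlanarField.mollify ρ (fun x => u x ^ 2) x = ∫ x, u x ^ 2 := by
    rw [PlanarField.mollify, integral_convolution _ hu₂ hρi, h₁]
    simp
  rw [← e]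
  refine integral_mono_of_nonneg (ae_of_all _ fun x => sq_nonneg _)
    (hu₂.integrable_convolution _ hρi) (ae_of_all _ fun x => ?_)
  change PlanarField.mollify ρ u x ^ 2 ≤ PlanarField.mollify ρ (fun x => u x ^ 2) x
  set c := PlanarField.mollify ρ u x with hc
  have i₁ := hρ.integrable_mul_translate hl x
  have i₂ := hρ.integrable_mul_translate hu₂.locallyIntegrable x
  have i₃ : Integrable (fun t => ρ (x - t)) := hρi.comp_sub_left x
  -- Jensen's inequality for the square: `c` is the mean of `u` under the probability density `ρ (x
  -- - ·)`, and expanding the nonnegative variance bounds `c ^ 2` by the mean of `u ^ 2`.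
  have h : 0 ≤ ∫ t, (u t - c) ^ 2 * ρ (x - t) :=
    integral_nonneg fun t => mul_nonneg (sq_nonneg _) (h₀ _)
  have e₁ : ∫ t, (u t - c) ^ 2 * ρ (x - t) =
      ∫ t, (u t ^ 2 * ρ (x - t) - 2 * c * (u t * ρ (x - t)) + c ^ 2 * ρ (x - t)) := by
    congr 1
    ext t
    ring
  have i₄ : Integrable (fun t => u t ^ 2 * ρ (x - t) - 2 * c * (u t * ρ (x - t))) :=
    i₂.sub (i₁.const_mul _)
  have e₂ : ∫ t, ρ (x - t) = 1 := by rw [integral_sub_left_eq_self, h₁]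
  rw [e₁, integral_add i₄ (i₃.const_mul _), integral_sub i₂ (i₁.const_mul _),
    integral_const_mul, integral_const_mul, e₂, ← mollify_apply, ← mollify_apply, ← hc] at h
  rw [mollify_apply] at h ⊢
  nlinarith

/-- Mollifications of an integrable function converge to it in the sense of distributions. -/
theorem tendsto_integral_mollify_mul {φ : ℕ → ContDiffBump (0 : Plane)}
    (hφ : Tendsto (fun n => (φ n).rOut) atTop (𝓝 0)) {f : Plane → ℝ} (hu : Integrable u)
    (hf : Continuous f) (hc : HasCompactSupport f) :
    Tendsto (fun n => ∫ x, mollify ((φ n).normed volume) u x * f x) atTop (𝓝 (∫ x, u x * f x)) := by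
  obtain ⟨C, hC⟩ := hc.exists_bound_of_continuous hf
  have hρ : ∀ n, Integrable ((φ n).normed volume) := fun n => (φ n).integrable_normed
  -- Fubini and the evenness of the bump move the mollifier from `u` onto the continuous function
  -- `f`, where convergence is pointwise and bounded by `C`.
  have swap : ∀ n, ∫ x, mollify ((φ n).normed volume) u x * f x =
      ∫ t, u t * (convolution ((φ n).normed volume) f (ContinuousLinearMap.lsmul ℝ ℝ) volume) t := by
    intro n
    have I : Integrable (fun p : Plane × Plane =>
        u p.2 * (φ n).normed volume (p.1 - p.2) * f p.1) (volume.prod volume) :=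
      (hu.convolution_integrand (ContinuousLinearMap.lsmul ℝ ℝ) (hρ n)).mul_bdd (c := C)
        (hf.comp continuous_fst).aestronglyMeasurable (ae_of_all _ fun p => hC _)
    simp only [mollify_apply, ← integral_mul_const]
    rw [integral_integral_swap (f := fun x t => u t * (φ n).normed volume (x - t) * f x) I]
    congr 1
    ext t
    rw [convolution_eq_swap, ← integral_const_mul]
    congr 1
    ext x
    rw [← (φ n).normed_neg, neg_sub]
    simp [mul_assoc]
  simp only [swap]
  refine tendsto_integral_filter_of_dominated_convergence (fun t => ‖u t‖ * C)
    (Eventually.of_forall fun n => hu.1.mul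
      (hc.continuous_convolution_right _ (hρ n).locallyIntegrable hf).aestronglyMeasurable)
    (Eventually.of_forall fun n => ae_of_all _ fun t => ?_) (hu.norm.mul_const C)
    (ae_of_all _ fun t => ((ContDiffBump.convolution_tendsto_right_of_continuous hφ hf t).const_mul
      (u t)))
  rw [norm_mul]
  refine mul_le_mul_of_nonneg_left ?_ (norm_nonneg _)
  have := norm_integral_le_of_norm_le ((hρ n).mul_const C)
    (f := fun s => (φ n).normed volume s • f (t - s)) (ae_of_all _ fun s => by
      rw [norm_smul, Real.norm_of_nonneg ((φ n).nonneg_normed s)]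
      exact mul_le_mul_of_nonneg_left (hC _) ((φ n).nonneg_normed s))
  rwa [integral_mul_const, (φ n).integral_normed, one_mul] at this

theorem norm_toLp_le_sqrt {f : Plane → ℝ} (hf : MemLp f 2) {C : ℝ} (hC : ∫ x, f x ^ 2 ≤ C) :
    ‖hf.toLp f‖ ≤ √C := by
  refine Real.le_sqrt_of_sq_le (le_trans (le_of_eq ?_) hC)
  rw [← real_inner_self_eq_norm_sq, L2.inner_def]
  refine integral_congr_ae ?_
  filter_upwards [hf.coeFn_toLp] with x hx
  rw [hx]
  simp [sq]

/-- A square integrable, compactly supported field on the plane whose weak divergence and curl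
are square integrable has square integrable weak partial derivatives. -/
theorem exists_weak_partial_of_div_curl {f : Fin 2 → Plane → ℝ} {a b : Plane → ℝ}
    (hf : ∀ j, MemLp (f j) 2) (hc : ∀ j, HasCompactSupport (f j)) (ha : MemLp a 2)
    (hb : MemLp b 2) (hdiv : HasWeakDiv Set.univ (f 0) (f 1) b)
    (hcurl : HasWeakDiv Set.univ (fun x => -f 1 x) (f 0) a) (i j : Fin 2) :
    ∃ g, MemLp g 2 ∧ ∀ η, IsTest Set.univ η →
      ∫ x, f j x * partialDeriv i η x = -∫ x, g x * η x := by
  have hl : ∀ j, LocallyIntegrable (f j) := fun j => (hf j).locallyIntegrable (by norm_num)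
  have hint : Integrable (f j) := by
    rw [← integrableOn_iff_integrable_of_support_subset (subset_tsupport (f j))]
    exact (hl j).integrableOn_isCompact (hc j)
  let φ : ℕ → ContDiffBump (0 : Plane) := fun n =>
    ⟨1 / (n + 2 : ℝ), 1 / (n + 1 : ℝ), by positivity, by gcongr; norm_num⟩
  have hφ : Tendsto (fun n => (φ n).rOut) atTop (𝓝 0) := tendsto_one_div_add_atTop_nhds_zero_nat
  let ρ : ℕ → Plane → ℝ := fun n => (φ n).normed volume
  have hρ : ∀ n, IsTest Set.univ (ρ n) := fun n =>
    ⟨(φ n).contDiff_normed, (φ n).hasCompactSupport_normed, Set.subset_univ _⟩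
  have hU : ∀ n j, IsTest Set.univ (mollify (ρ n) (f j)) := fun n j =>
    (hρ n).mollify (hl j) (hc j)
  have hm : ∀ n, MemLp (partialDeriv i (mollify (ρ n) (f j))) 2 := fun n => by
    simpa using (hU n j).memLp_partialDeriv i
  -- The divergence and curl of the mollified field are the mollifications of `b` and `a`, so the
  -- energy identity gives a bound independent of `n`.
  have hbd : ∀ n, ∫ x, partialDeriv i (mollify (ρ n) (f j)) x ^ 2 ≤
      (∫ x, b x ^ 2) + ∫ x, a x ^ 2 := by
    intro n
    refine (IsTest.integral_sq_partialDeriv_le (hU n) i j).trans (add_le_add ?_ ?_)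
    · simp only [hdiv.mollify (hl 0) (hl 1) (hρ n)]
      exact (hρ n).integral_sq_mollify_le (φ n).nonneg_normed (φ n).integral_normed hb
    · have : ∀ x, partialDeriv 1 (mollify (ρ n) (f 0)) x - partialDeriv 0 (mollify (ρ n) (f 1)) x =
          mollify (ρ n) a x := fun x => by
        rw [← hcurl.mollify (hl 1).neg (hl 0) (hρ n), (hρ n).partialDeriv_mollify (hl 1),
          (hρ n).partialDeriv_mollify (u := fun x => -f 1 x) (hl 1).neg]
        simp only [neg_mul, integral_neg]
        ring
      simp only [this]
      exact (hρ n).integral_sq_mollify_le (φ n).nonneg_normed (φ n).integral_normed ha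
  obtain ⟨g, hg⟩ := exists_weak_limit (fun n => (hm n).toLp _) _
    fun n => norm_toLp_le_sqrt (hm n) (hbd n)
  refine ⟨g, Lp.memLp g, fun η hη => ?_⟩
  have hη₂ : MemLp η 2 := by simpa using hη.memLp
  have e : ∀ n, inner ℝ ((hm n).toLp _) (hη₂.toLp η) =
      -∫ x, mollify (ρ n) (f j) x * partialDeriv i η x := by
    intro n
    rw [(hU n j).integral_mul_partialDeriv hη, neg_neg, L2.inner_def]
    refine integral_congr_ae ?_
    filter_upwards [(hm n).coeFn_toLp, hη₂.coeFn_toLp] with x h₁ h₂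
    rw [h₁, h₂]
    simp [mul_comm]
  have e' : inner ℝ g (hη₂.toLp η) = ∫ x, g x * η x := by
    rw [L2.inner_def]
    refine integral_congr_ae ?_
    filter_upwards [hη₂.coeFn_toLp] with x h₂
    rw [h₂]
    simp [mul_comm]
  have t₁ := hg (hη₂.toLp η)
  simp only [e, e'] at t₁
  -- The same pairings also converge in the sense of distributions; restricting that limit to the
  -- hyperfilter lets the two limits be identified.
  have t₂ := ((tendsto_integral_mollify_mul hφ hint (hη.partialDeriv i).smooth.continuous
    (hη.partialDeriv i).compact).neg).mono_left Nat.hyperfilter_le_atTop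
  rw [tendsto_nhds_unique t₁ t₂, neg_neg]

end Mollify

/-! ### Cutoffs, restriction to smaller open sets, and algebra of `MemH` -/

theorem exists_isTest_eq_one {K U : Set Plane} (hK : IsCompact K) (hU : IsOpen U) (h : K ⊆ U) :
    ∃ χ, IsTest U χ ∧ ∀ x ∈ K, χ x = 1 := by
  obtain ⟨V, hV, hKV, hVU, hVc⟩ := exists_open_between_and_isCompact_closure hK hU h
  obtain ⟨χ, hχ, -, hs, h₁⟩ := exists_contMDiff_support_eq_eq_one_iff
    (modelWithCornersSelf ℝ Plane) (n := ⊤) hV hK.isClosed hKV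
  have ht : tsupport χ = closure V := by rw [tsupport, hs]
  exact ⟨χ, ⟨hχ.contDiff, by rwa [HasCompactSupport, ht], by rwa [ht]⟩, fun x hx => (h₁ x).1 hx⟩

section Restrict

variable {U V : Set Plane}

theorem setIntegral_mul_partialDeriv_eq (hU : MeasurableSet U) (h : V ⊆ U) {η : Plane → ℝ}
    (hη : IsTest V η) (f : Plane → ℝ) (i : Fin 2) :
    ∫ x in U, f x * partialDeriv i η x = ∫ x in V, f x * partialDeriv i η x :=
  setIntegral_eq_of_subset_of_forall_sdiff_eq_zero hU h fun x hx => by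
    rw [hη.partialDeriv_eq_zero hx.2, mul_zero]

theorem setIntegral_mul_test_eq (hU : MeasurableSet U) (h : V ⊆ U) {η : Plane → ℝ}
    (hη : IsTest V η) (f : Plane → ℝ) :
    ∫ x in U, f x * η x = ∫ x in V, f x * η x :=
  setIntegral_eq_of_subset_of_forall_sdiff_eq_zero hU h fun x hx => by
    rw [hη.eq_zero hx.2, mul_zero]

theorem HasWeakPartial.mono (hU : MeasurableSet U) (h : V ⊆ U) {i : Fin 2} {f g : Plane → ℝ}
    (hf : HasWeakPartial U i f g) : HasWeakPartial V i f g := by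
  refine ⟨hf.locInt.mono_set h, hf.locInt_deriv.mono_set h, fun η hη => ?_⟩
  rw [← setIntegral_mul_partialDeriv_eq hU h hη, ← setIntegral_mul_test_eq hU h hη]
  exact hf.integral_eq η (hη.mono h)

theorem HasWeakDiv.mono (hU : MeasurableSet U) (h : V ⊆ U) {f g b : Plane → ℝ}
    (hf : HasWeakDiv U f g b) : HasWeakDiv V f g b := by
  intro η hη
  rw [← setIntegral_mul_test_eq hU h hη, ← hf η (hη.mono h)]
  refine (setIntegral_eq_of_subset_of_forall_sdiff_eq_zero hU h fun x hx => ?_).symm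
  rw [hη.partialDeriv_eq_zero hx.2, hη.partialDeriv_eq_zero hx.2, mul_zero, mul_zero, add_zero]

theorem MemH.memLp {m : ℕ} {f : Plane → ℝ} (hf : MemH m U f) :
    MemLp f 2 (volume.restrict U) := by
  cases m with
  | zero => exact hf
  | succ m => exact hf.1

theorem MemH.mono {m : ℕ} (hU : MeasurableSet U) (h : V ⊆ U) {f : Plane → ℝ} (hf : MemH m U f) :
    MemH m V f := by
  induction m generalizing f with
  | zero => exact MemLp.mono_measure (Measure.restrict_mono_set _ h) hf
  | succ m ih =>
    refine ⟨hf.1.mono_measure (Measure.restrict_mono_set _ h), fun i => ?_⟩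
    obtain ⟨g, hg, hm⟩ := hf.2 i
    exact ⟨g, hg.mono hU h, ih hm⟩

theorem HasWeakPartial.of_memLp {i : Fin 2} {f g : Plane → ℝ}
    (hf : MemLp f 2 (volume.restrict U)) (hg : MemLp g 2 (volume.restrict U))
    (h : ∀ η, IsTest U η → ∫ x in U, f x * partialDeriv i η x = -∫ x in U, g x * η x) :
    HasWeakPartial U i f g :=
  ⟨locallyIntegrableOn_of_memLp hf, locallyIntegrableOn_of_memLp hg, h⟩

/-- No induction is needed: `f` and `g` share the same weak derivatives, so only the outermost
function changes. -/
theorem MemH.congr {m : ℕ} {f g : Plane → ℝ} (hf : MemH m U f)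
    (h : f =ᵐ[volume.restrict U] g) : MemH m U g := by
  cases m with
  | zero => exact MemLp.ae_eq h hf
  | succ m =>
    refine ⟨hf.1.ae_eq h, fun i => ?_⟩
    obtain ⟨k, hk, hm⟩ := hf.2 i
    refine ⟨k, .of_memLp (hf.1.ae_eq h) hm.memLp fun η hη => ?_, hm⟩
    rw [← hk.integral_eq η hη]
    refine integral_congr_ae ?_
    filter_upwards [h] with x hx
    rw [hx]

theorem MemH.add {m : ℕ} {f g : Plane → ℝ} (hf : MemH m U f) (hg : MemH m U g) :
    MemH m U (fun x => f x + g x) := by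
  induction m generalizing f g with
  | zero => exact MemLp.add hf hg
  | succ m ih =>
    refine ⟨hf.1.add hg.1, fun i => ?_⟩
    obtain ⟨f', hf', hfm⟩ := hf.2 i
    obtain ⟨g', hg', hgm⟩ := hg.2 i
    refine ⟨_, .of_memLp (hf.1.add hg.1) (ih hfm hgm).memLp fun η hη => ?_, ih hfm hgm⟩
    simp only [add_mul]
    rw [integral_add (hη.integrable_mul hfm.memLp) (hη.integrable_mul hgm.memLp),
      integral_add ((hη.partialDeriv i).integrable_mul hf.1)
        ((hη.partialDeriv i).integrable_mul hg.1), hf'.integral_eq η hη, hg'.integral_eq η hη]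
    ring

theorem HasWeakPartial.neg {i : Fin 2} {f g : Plane → ℝ} (h : HasWeakPartial U i f g) :
    HasWeakPartial U i (fun x => -f x) (fun x => -g x) := by
  refine ⟨h.locInt.neg, h.locInt_deriv.neg, fun η hη => ?_⟩
  simp only [neg_mul, integral_neg, h.integral_eq η hη]

theorem MemH.neg {m : ℕ} {f : Plane → ℝ} (hf : MemH m U f) : MemH m U (fun x => -f x) := by
  induction m generalizing f with
  | zero => exact MemLp.neg hf
  | succ m ih =>
    refine ⟨hf.1.neg, fun i => ?_⟩
    obtain ⟨f', hf', hfm⟩ := hf.2 i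
    exact ⟨_, hf'.neg, ih hfm⟩

theorem MemH.zero (m : ℕ) : MemH m U (fun _ => 0) := by
  induction m with
  | zero => exact MemLp.zero'
  | succ m ih =>
    exact ⟨MemLp.zero', fun i => ⟨_, .of_memLp MemLp.zero' MemLp.zero' (by simp), ih⟩⟩

/-- The partial derivatives of a weak divergence equation. -/
theorem HasWeakDiv.weakPartial {i : Fin 2} {f g b f' g' b' : Plane → ℝ}
    (h : HasWeakDiv U f g b) (hf : HasWeakPartial U i f f') (hg : HasWeakPartial U i g g')
    (hb : HasWeakPartial U i b b') (mf : MemLp f 2 (volume.restrict U))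
    (mg : MemLp g 2 (volume.restrict U)) (mf' : MemLp f' 2 (volume.restrict U))
    (mg' : MemLp g' 2 (volume.restrict U)) : HasWeakDiv U f' g' b' := by
  intro η hη
  have e := h _ (hη.partialDeriv i)
  simp only [partialDeriv_comm hη.smooth _ i] at e
  rw [integral_add (((hη.partialDeriv 0).partialDeriv i).integrable_mul mf)
      (((hη.partialDeriv 1).partialDeriv i).integrable_mul mg),
    hf.integral_eq _ (hη.partialDeriv 0), hg.integral_eq _ (hη.partialDeriv 1),
    hb.integral_eq η hη] at e
  rw [integral_add ((hη.partialDeriv 0).integrable_mul mf')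
    ((hη.partialDeriv 1).integrable_mul mg')]
  linarith

end Restrict

/-! ### Localization and interior regularity of the div-curl system -/

section Local

variable {O U : Set Plane}

/-- The values of `f` outside `O` are arbitrary, but `χ` vanishes there, so the product equals its
own indicator on `O`. -/
theorem IsTest.memLp_mul {χ f : Plane → ℝ} (hχ : IsTest O χ) (hO : MeasurableSet O)
    (hf : MemLp f 2 (volume.restrict O)) : MemLp (fun x => χ x * f x) 2 := by
  have h : MemLp (fun x => χ x * f x) 2 (volume.restrict O) :=
    MemLp.mul' (p := ∞) (q := 2) hf
      (hχ.smooth.continuous.memLp_of_hasCompactSupport hχ.compact)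
  rw [← memLp_indicator_iff_restrict hO] at h
  refine h.ae_eq (ae_of_all _ fun x => ?_)
  by_cases hx : x ∈ O
  · simp [hx]
  · simp [hx, hχ.eq_zero hx]

/-- The product rule, obtained by testing on `O` with `η χ`. The extra term `∇χ · (f, g)` involves
no derivative of the field, so it is square integrable as soon as the field is. -/
theorem HasWeakDiv.cutoff {f g b χ : Plane → ℝ} (h : HasWeakDiv O f g b)
    (hf : MemLp f 2 (volume.restrict O)) (hg : MemLp g 2 (volume.restrict O)) (hb : MemLp b 2 (volume.restrict O))
    (hχ : IsTest O χ) :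
    HasWeakDiv Set.univ (fun x => χ x * f x) (fun x => χ x * g x)
      (fun x => χ x * b x + (partialDeriv 0 χ x * f x + partialDeriv 1 χ x * g x)) := by
  intro η hη
  have hχη : IsTest O (fun x => η x * χ x) := hχ.mul_left hη.smooth
  have hd : ∀ i, IsTest O (fun x => η x * partialDeriv i χ x) := fun i =>
    (hχ.partialDeriv i).mul_left hη.smooth
  have e := h _ hχη
  simp only [partialDeriv_mul hη.smooth hχ.smooth] at e
  rw [setIntegral_eq_of_subset_of_forall_sdiff_eq_zero MeasurableSet.univ (Set.subset_univ O),
    setIntegral_eq_of_subset_of_forall_sdiff_eq_zero MeasurableSet.univ (Set.subset_univ O)]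
  · have i₁ := hχη.integrable_mul hb
    have i₂ : Integrable (fun x => f x * (η x * partialDeriv 0 χ x) +
        g x * (η x * partialDeriv 1 χ x)) (volume.restrict O) :=
      ((hd 0).integrable_mul hf).add ((hd 1).integrable_mul hg)
    have i₃ : Integrable (fun x => f x * (partialDeriv 0 η x * χ x) +
        g x * (partialDeriv 1 η x * χ x)) (volume.restrict O) :=
      ((hχ.mul_left (contDiff_partialDeriv hη.smooth 0)).integrable_mul hf).add
        ((hχ.mul_left (contDiff_partialDeriv hη.smooth 1)).integrable_mul hg)
    have e₁ : ∫ x in O, (f x * (η x * partialDeriv 0 χ x + partialDeriv 0 η x * χ x) +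
        g x * (η x * partialDeriv 1 χ x + partialDeriv 1 η x * χ x)) =
        (∫ x in O, (f x * (η x * partialDeriv 0 χ x) + g x * (η x * partialDeriv 1 χ x))) +
        ∫ x in O, (f x * (partialDeriv 0 η x * χ x) + g x * (partialDeriv 1 η x * χ x)) := by
      rw [← integral_add i₂ i₃]
      congr 1
      ext x
      ring
    have e₂ : ∫ x in O, (χ x * b x + (partialDeriv 0 χ x * f x + partialDeriv 1 χ x * g x)) * η x =
        (∫ x in O, b x * (η x * χ x)) +
        ∫ x in O, (f x * (η x * partialDeriv 0 χ x) + g x * (η x * partialDeriv 1 χ x)) := by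
      rw [← integral_add i₁ i₂]
      congr 1
      ext x
      ring
    have e₃ : ∫ x in O, (χ x * f x * partialDeriv 0 η x + χ x * g x * partialDeriv 1 η x) =
        ∫ x in O, (f x * (partialDeriv 0 η x * χ x) + g x * (partialDeriv 1 η x * χ x)) := by
      congr 1
      ext x
      ring
    rw [e₂, e₃]
    linarith
  · intro x hx
    simp [hχ.eq_zero hx.2, hχ.partialDeriv_eq_zero hx.2]
  · intro x hx
    simp [hχ.eq_zero hx.2]

/-- A cutoff equal to `1` on `closure U` reduces this to the whole plane; test functions supported
in `U` do not see the cutoff. -/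
theorem exists_hasWeakPartial_of_div_curl (hO : IsOpen O) (hU : IsOpen U)
    (hc : IsCompact (closure U)) (hUO : closure U ⊆ O) {f : Fin 2 → Plane → ℝ} {a b : Plane → ℝ}
    (hf : ∀ j, MemLp (f j) 2 (volume.restrict O)) (ha : MemLp a 2 (volume.restrict O))
    (hb : MemLp b 2 (volume.restrict O)) (hdiv : HasWeakDiv O (f 0) (f 1) b)
    (hcurl : HasWeakDiv O (fun x => -f 1 x) (f 0) a) (i j : Fin 2) :
    ∃ g, MemLp g 2 (volume.restrict U) ∧ HasWeakPartial U i (f j) g := by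
  obtain ⟨χ, hχ, h₁⟩ := exists_isTest_eq_one hc hO hUO
  have hOm := hO.measurableSet
  have hd := hdiv.cutoff (hf 0) (hf 1) hb hχ
  have hr := hcurl.cutoff (hf 1).neg (hf 0) ha hχ
  simp only [mul_neg] at hr
  obtain ⟨g, hg, h⟩ := exists_weak_partial_of_div_curl (f := fun j x => χ x * f j x)
    (fun j => hχ.memLp_mul hOm (hf j)) (fun j => hχ.compact.mul_right)
    ((hχ.memLp_mul hOm ha).add (((hχ.partialDeriv 0).memLp_mul hOm (hf 1)).neg.add
      ((hχ.partialDeriv 1).memLp_mul hOm (hf 0))))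
    ((hχ.memLp_mul hOm hb).add (((hχ.partialDeriv 0).memLp_mul hOm (hf 0)).add
      ((hχ.partialDeriv 1).memLp_mul hOm (hf 1)))) hd hr i j
  refine ⟨g, hg.restrict U, .of_memLp ((hf j).mono_measure
    (Measure.restrict_mono_set _ (subset_closure.trans hUO))) (hg.restrict U) fun η hη => ?_⟩
  have e := h η (hη.mono (Set.subset_univ _))
  rw [← setIntegral_univ, ← setIntegral_univ (f := fun x => g x * η x),
    setIntegral_mul_partialDeriv_eq MeasurableSet.univ (Set.subset_univ U) hη,
    setIntegral_mul_test_eq MeasurableSet.univ (Set.subset_univ U) hη] at e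
  rw [← e]
  refine setIntegral_congr_fun hU.measurableSet fun x hx => ?_
  simp only [h₁ x (subset_closure hx), one_mul]

/-- Interior elliptic regularity for the div-curl system: a square integrable field with
divergence and curl in `H^k` is in `H^(k+1)` on relatively compact open subsets. -/
theorem memH_succ_of_div_curl (k : ℕ) (hO : IsOpen O) (hU : IsOpen U)
    (hc : IsCompact (closure U)) (hUO : closure U ⊆ O) {f : Fin 2 → Plane → ℝ} {a b : Plane → ℝ}
    (hf : ∀ j, MemLp (f j) 2 (volume.restrict O)) (ha : MemH k O a)
    (hb : MemH k O b) (hdiv : HasWeakDiv O (f 0) (f 1) b)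
    (hcurl : HasWeakDiv O (fun x => -f 1 x) (f 0) a) (j : Fin 2) : MemH (k + 1) U (f j) := by
  refine ⟨(hf j).mono_measure (Measure.restrict_mono_set _ (subset_closure.trans hUO)),
    fun i => ?_⟩
  -- The domain is generalized because each derivative is obtained only on a smaller set, which then
  -- takes the place of `O`.
  induction k generalizing O f a b i j with
  | zero =>
    obtain ⟨g, hg, h⟩ := exists_hasWeakPartial_of_div_curl hO hU hc hUO hf ha hb hdiv hcurl i j
    exact ⟨g, h, hg⟩
  | succ k ih =>
    obtain ⟨V, hV, hUV, hVO, hVc⟩ := exists_open_between_and_isCompact_closure hc hO hUO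
    have hVO' : V ⊆ O := subset_closure.trans hVO
    have hOm := hO.measurableSet
    choose g hg hp using fun j => exists_hasWeakPartial_of_div_curl hO hV hVc hVO hf
      ha.memLp hb.memLp hdiv hcurl i j
    obtain ⟨a', ha', hma⟩ := ha.2 i
    obtain ⟨b', hb', hmb⟩ := hb.2 i
    have hf' : ∀ j, MemLp (f j) 2 (volume.restrict V) := fun j =>
      (hf j).mono_measure (Measure.restrict_mono_set _ hVO')
    refine ⟨g j, (hp j).mono hV.measurableSet (subset_closure.trans hUV),
      (hg j).mono_measure (Measure.restrict_mono_set _ (subset_closure.trans hUV)), fun i => ?_⟩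
    -- The differentiated field `(g 0, g 1)` solves the same system on `V`, with data `a'` and `b'`
    -- one order lower.
    exact ih hV hUV hg (hma.mono hOm hVO') (hmb.mono hOm hVO')
      ((hdiv.mono hOm hVO').weakPartial (hp 0) (hp 1) (hb'.mono hOm hVO') (hf' 0) (hf' 1)
        (hg 0) (hg 1))
      ((hcurl.mono hOm hVO').weakPartial (hp 1).neg (hp 0) (ha'.mono hOm hVO') (hf' 1).neg (hf' 0)
        (hg 1).neg (hg 0)) j i

end Local

/-! ### Weak equations satisfied by the projections -/

section Projection

variable {Ω : Set Plane}

theorem memLp_testField {η ζ : Plane → ℝ} (hη : IsTest Ω η) (hζ : IsTest Ω ζ) :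
    MemLp (fun x => η x • (EuclideanSpace.single 0 1 : Plane) +
      ζ x • (EuclideanSpace.single 1 1 : Plane)) 2 (volume.restrict Ω) := by
  have h : ∀ {θ : Plane → ℝ} (_ : IsTest Ω θ) (e : Plane),
      MemLp (fun x => θ x • e) 2 (volume.restrict Ω) := fun {θ} hθ e =>
    (ContinuousLinearMap.toSpanSingleton ℝ e).comp_memLp' hθ.memLp
  exact (h hη _).add (h hζ _)

/-- The smooth compactly supported field `(η, ζ)` as an element of `L²(Ω; ℝ²)`. -/
def testField {η ζ : Plane → ℝ} (hη : IsTest Ω η) (hζ : IsTest Ω ζ) : L2Field Ω :=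
  (memLp_testField hη hζ).toLp _

theorem testField_apply {η ζ : Plane → ℝ} (hη : IsTest Ω η) (hζ : IsTest Ω ζ) :
    ∀ᵐ x ∂volume.restrict Ω, testField hη hζ x 0 = η x ∧ testField hη hζ x 1 = ζ x := by
  filter_upwards [(memLp_testField hη hζ).coeFn_toLp] with x hx
  rw [testField, hx]
  simp

theorem inner_testField {η ζ : Plane → ℝ} (hη : IsTest Ω η) (hζ : IsTest Ω ζ) (w : L2Field Ω) :
    inner ℝ w (testField hη hζ) = ∫ x in Ω, (w x 0 * η x + w x 1 * ζ x) := by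
  rw [L2.inner_def]
  refine integral_congr_ae ?_
  filter_upwards [testField_apply hη hζ] with x hx
  simp [PiLp.inner_apply, hx.1, hx.2, mul_comm]

/-- A test function is its own approximating sequence. This supplies the test fields against which
`v - P v` is orthogonal, hence the divergence equation. -/
theorem testField_partialDeriv_mem_gradSpaceZero {η : Plane → ℝ} (hη : IsTest Ω η) :
    testField (hη.partialDeriv 0) (hη.partialDeriv 1) ∈ gradSpaceZero Ω := by
  have ha : ∀ i, (fun x => testField (hη.partialDeriv 0) (hη.partialDeriv 1) x i)
      =ᵐ[volume.restrict Ω] partialDeriv i η := by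
    intro i
    filter_upwards [testField_apply (hη.partialDeriv 0) (hη.partialDeriv 1)] with x hx
    fin_cases i
    exacts [hx.1, hx.2]
  refine ⟨η, ⟨hη.memLp, fun i => .of_memLp hη.memLp (L2Field.memLp_apply _ i) fun ζ hζ => ?_⟩,
    fun _ => η, fun _ => hη, by simp, fun i => ?_⟩
  · have e : ∫ x in Ω, testField (hη.partialDeriv 0) (hη.partialDeriv 1) x i * ζ x =
        ∫ x in Ω, partialDeriv i η x * ζ x := by
      refine integral_congr_ae ?_
      filter_upwards [ha i] with x hx
      rw [hx]
    rw [e]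
    have h := hη.integral_mul_partialDeriv hζ i
    rwa [← setIntegral_eq_integral_of_forall_compl_eq_zero (s := Ω)
        (f := fun x => η x * partialDeriv i ζ x) fun x hx => by simp [hη.eq_zero hx],
      ← setIntegral_eq_integral_of_forall_compl_eq_zero (s := Ω)
        (f := fun x => partialDeriv i η x * ζ x) fun x hx => by simp [hζ.eq_zero hx]] at h
  · have e : eLpNorm (fun x => partialDeriv i η x -
        testField (hη.partialDeriv 0) (hη.partialDeriv 1) x i) 2 (volume.restrict Ω) = 0 := by
      rw [eLpNorm_congr_ae (g := fun _ => (0 : ℝ)) ?_]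
      · simp
      · filter_upwards [ha i] with x hx
        rw [hx, sub_self]
    simp only [e]
    exact tendsto_const_nhds

theorem gradSpaceZero_le_gradSpace : gradSpaceZero Ω ≤ gradSpace Ω :=
  fun _ ⟨φ, h⟩ => ⟨φ, h.isGrad⟩

/-- Limits of gradients are weakly curl-free. -/
theorem hasWeakDiv_rot_of_mem_closure {w : L2Field Ω}
    (hw : w ∈ (gradSpace Ω).topologicalClosure) :
    HasWeakDiv Ω (fun x => -w x 1) (fun x => w x 0) (fun _ => 0) := by
  intro η hη
  -- The rotated gradient `(∂₁η, -∂₀η)` is orthogonal to every gradient by symmetry of second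
  -- derivatives; continuity of the inner product carries this to the closure.
  let z := testField (hη.partialDeriv 1) ((hη.partialDeriv 0).smul (-1))
  have hz : ∀ y : L2Field Ω, inner ℝ y z =
      ∫ x in Ω, (-y x 1 * partialDeriv 0 η x + y x 0 * partialDeriv 1 η x) := by
    intro y
    rw [inner_testField]
    congr 1
    ext x
    ring
  have hc : IsClosed {y : L2Field Ω | inner ℝ y z = 0} :=
    isClosed_eq (continuous_id.inner continuous_const) continuous_const
  have hs : (gradSpace Ω : Set (L2Field Ω)) ⊆ {y | inner ℝ y z = 0} := by
    rintro y ⟨φ, hφ⟩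
    change inner ℝ y z = 0
    have i₀ := (hη.partialDeriv 1).integrable_mul (L2Field.memLp_apply y 0)
    have i₁ := (hη.partialDeriv 0).integrable_mul (L2Field.memLp_apply y 1)
    have h₀ := (hφ.weak 0).integral_eq _ (hη.partialDeriv 1)
    have h₁ := (hφ.weak 1).integral_eq _ (hη.partialDeriv 0)
    simp only [partialDeriv_comm hη.smooth 0 1] at h₀
    rw [hz]
    simp only [neg_mul, neg_add_eq_sub]
    rw [integral_sub i₀ i₁]
    linarith
  have : inner ℝ w z = 0 := closure_minimal hs hc hw
  rw [← hz, this]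
  simp

theorem IsHOn.sub {m : ℕ} {O : Set Plane} (hO : O ⊆ Ω) {v w : L2Field Ω} (hv : IsHOn m O v)
    (hw : IsHOn m O w) : IsHOn m O (v - w) := by
  intro i U hU hc hUO
  refine ((hv i U hU hc hUO).add (hw i U hU hc hUO).neg).congr ?_
  filter_upwards [ae_mono (Measure.restrict_mono_set _ ((subset_closure.trans hUO).trans hO))
    (Lp.coeFn_sub v w)] with x hx
  rw [hx]
  simp [sub_eq_add_neg]

/-- The orthogonal projection onto the closure of a space of gradients that contains the gradients
of test functions preserves interior Sobolev regularity. -/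
theorem IsHOn.starProjection (hΩ : IsOpen Ω) {S : Submodule ℝ (L2Field Ω)}
    (h₀ : gradSpaceZero Ω ≤ S) (h₁ : S ≤ gradSpace Ω) {O : Set Plane} (hO : IsOpen O)
    (hOΩ : O ⊆ Ω) {m : ℕ} (hm : 1 ≤ m) {v : L2Field Ω} (hv : IsHOn m O v) :
    IsHOn m O (S.topologicalClosure.starProjection v) := by
  -- With `m = k + 1` the weak divergence of `v` exists locally as a function in `H^k`.
  obtain ⟨k, rfl⟩ : ∃ k, m = k + 1 := ⟨m - 1, by omega⟩
  set w := S.topologicalClosure.starProjection v with hw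
  intro j U hU hc hUO
  -- Interior regularity of `v` gives data up to the edge of `V` only when `closure V` is compact in
  -- `O`; the order is then gained in passing from `V` to `U`.
  obtain ⟨V, hV, hUV, hVO, hVc⟩ := exists_open_between_and_isCompact_closure hc hO hUO
  have hVΩ : V ⊆ Ω := (subset_closure.trans hVO).trans hOΩ
  choose g hg hgm using fun i => (hv i V hV hVc hVO).2 i
  have hmono : ∀ (y : L2Field Ω) i, MemLp (fun x => y x i) 2 (volume.restrict V) := fun y i =>
    (L2Field.memLp_apply y i).mono_measure (Measure.restrict_mono_set _ hVΩ)
  have hcurl := hasWeakDiv_rot_of_mem_closure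
    (Submodule.topologicalClosure_mono h₁ (S.topologicalClosure.starProjection_apply_mem v))
  have hdiv : HasWeakDiv V (fun x => w x 0) (fun x => w x 1) (fun x => g 0 x + g 1 x) := by
    intro η hη
    have hη' := hη.mono hVΩ
    -- Orthogonality of `v - w` to `∇η` is the weak form of `div w = div v`.
    have ho : inner ℝ (v - w) (testField (hη'.partialDeriv 0) (hη'.partialDeriv 1)) = 0 :=
      Submodule.inner_left_of_mem_orthogonal
        (S.le_topologicalClosure (h₀ (testField_partialDeriv_mem_gradSpaceZero hη')))
        (S.topologicalClosure.sub_starProjection_mem_orthogonal v)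
    rw [inner_sub_left, inner_testField, inner_testField, sub_eq_zero] at ho
    have hr : ∀ y : L2Field Ω,
        ∫ x in Ω, (y x 0 * partialDeriv 0 η x + y x 1 * partialDeriv 1 η x) =
        ∫ x in V, (y x 0 * partialDeriv 0 η x + y x 1 * partialDeriv 1 η x) := fun y =>
      setIntegral_eq_of_subset_of_forall_sdiff_eq_zero hΩ.measurableSet hVΩ fun x hx => by
        simp [hη.partialDeriv_eq_zero hx.2]
    rw [← hr, ← ho, hr, integral_add ((hη.partialDeriv 0).integrable_mul (hmono v 0))
      ((hη.partialDeriv 1).integrable_mul (hmono v 1)), (hg 0).integral_eq η hη,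
      (hg 1).integral_eq η hη]
    simp only [add_mul]
    rw [integral_add (hη.integrable_mul (hgm 0).memLp) (hη.integrable_mul (hgm 1).memLp)]
    ring
  exact memH_succ_of_div_curl k hV hU hc hUV (f := fun j x => w x j) (hmono w) (MemH.zero k)
    ((hgm 0).add (hgm 1)) hdiv (hcurl.mono hΩ.measurableSet hVΩ) j

end Projection

end PlanarField

end

theorem theorem3p3 (Ω : Set PlanarField.Plane) (hΩ : PlanarField.ConditionB1 Ω)
    (O : Set PlanarField.Plane) (hO : IsOpen O) (hOΩ : closure O ⊆ Ω)
    (m : ℕ) (hm : 1 ≤ m) (v : PlanarField.L2Field Ω) (hv : PlanarField.IsHOn m O v) :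
    PlanarField.IsHOn m O (PlanarField.projG Ω v) ∧
    PlanarField.IsHOn m O (PlanarField.projG0 Ω v) ∧
    PlanarField.IsHOn m O (PlanarField.compG Ω v) ∧
    PlanarField.IsHOn m O (PlanarField.compG0 Ω v) := by
  have h : O ⊆ Ω := subset_closure.trans hOΩ
  -- The two projections are the extreme cases of a subspace between `G₀(Ω)` and `G(Ω)`.
  have hG : PlanarField.IsHOn m O (PlanarField.projG Ω v) :=
    hv.starProjection hΩ.isOpen PlanarField.gradSpaceZero_le_gradSpace le_rfl hO h hm
  have hG₀ : PlanarField.IsHOn m O (PlanarField.projG0 Ω v) :=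
    hv.starProjection hΩ.isOpen le_rfl PlanarField.gradSpaceZero_le_gradSpace hO h hm
  exact ⟨hG, hG₀, hv.sub h hG, hv.sub h hG₀⟩
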